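/- Let $\ell^2(\mathcal E)=\mathcal E\oplus\mathcal E\oplus\cdots$, let $T_z(c_0,c_1,\dots)=(0,c_0,c_1,\dots)$ be the unilateral shift on $\ell^2(\mathbb C^2)$, and for $\alpha\in\mathbb C$ with $|\alpha|\le 1$ let $H(c_0,c_1,c_2,\dots)=(H_1c_0,0,0,\dots)$ on $\ell^2(\mathbb C^2)$, where $H_1=\begin{pmatrix}0&\alpha\\0&0\end{pmatrix}$. On $\mathcal H=\ell^2(\mathbb C^2)\oplus\ell^2(\mathbb C^2)\oplus\ell^2(\mathbb C^2)\oplus\ell^2(\mathbb C^2)$ put $$A=A_\alpha=\begin{bmatrix}0&0&0&0\\0&0&0&0\\0&0&H&0\\0&0&0&0\end{bmatrix},\quad B=0,\quad P=\begin{bmatrix}0&0&0&0\\0&0&0&0\\0&T_z&0&0\\I&0&0&0\end{bmatrix}.$$ A tetrablock unitary is a commuting triple of bounded normal operators on a Hilbert space whose (Taylor) joint spectrum lies in $b\mathbb E=\{(u_{11},u_{22},\det U): U=(u_{ij})\text{ a unitary } 2\times2\text{ matrix}\}$; a tetrablock isometry is the restriction of a tetrablock unitary to a closed joint invariant subspace.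 A tetrablock isometric dilation of a triple $(T_1,T_2,T_3)$ on $\mathcal H$ is a tetrablock isometry $(V_1,V_2,V_3)$ on a Hilbert space $\mathcal K\supseteq\mathcal H$ with $V_i^*|_{\mathcal H}=T_i^*$ for $i=1,2,3$. Let $D_{P^*}=(I-PP^*)^{1/2}$ and $\mathcal D_{P^*}=\overline{\operatorname{Ran}}\,D_{P^*}$. Then the following hold. 1. $D_{P^*}=\begin{pmatrix}I&0\\0&I\end{pmatrix}\oplus\begin{pmatrix}I-T_zT_z^*&0\\0&0\end{pmatrix}$ and $\mathcal D_{P^*}=\left(\ell^2(\mathbb C^2)\oplus\ell^2(\mathbb C^2)\right)\oplus\left(\operatorname{Ker}T_z^*\oplus\{0\}\right)$. 2. The operators $G_1=0\oplus\begin{pmatrix}H^*&0\\0&0\end{pmatrix}$ and $G_2=0$ on $\mathcal D_{P^*}$ are the fundamental operators of $(A^*,B^*,P^*)$, i.e. $(G_1,G_2)$ is the unique pair of bounded operators on $\mathcal D_{P^*}$ with $A^*-BP^*=D_{P^*}G_1D_{P^*}$ and $B^*-AP^*=D_{P^*}G_2D_{P^*}$. 3. The block operator matrices $$W_1=\begin{bmatrix}A^*&0&0&0&\cdots\\G_1^*D_{P^*}&G_1&0&0&\cdots\\0&G_1^*&G_1&0&\cdots\\0&0&G_1^*&G_1&\cdots\\\vdots&\vdots&\vdots&\ddots&\ddots\end{bmatrix},\quad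 W_2=\begin{bmatrix}B^*&0&0&0&\cdots\\G_1D_{P^*}&0&0&0&\cdots\\G_1^*D_{P^*}&G_1&0&0&\cdots\\0&G_1^*&G_1&0&\cdots\\0&0&G_1^*&G_1&\cdots\\\vdots&\vdots&\vdots&\ddots&\ddots\end{bmatrix},\quad W_3=\begin{bmatrix}P^*&0&0&0&\cdots\\0&0&0&0&\cdots\\D_{P^*}&0&0&0&\cdots\\0&I&0&0&\cdots\\0&0&I&0&\cdots\\\vdots&\vdots&\vdots&\ddots&\ddots\end{bmatrix}$$ define bounded operators on $\mathcal K=\mathcal H\oplus\mathcal D_{P^*}\oplus\mathcal D_{P^*}\oplus\cdots$, and $(W_1,W_2,W_3)$ is a tetrablock isometric dilation of $(A^*,B^*,P^*)=(A_\alpha^*,0,P^*)$. -/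

import Mathlib

open scoped InnerProduct

noncomputable section

namespace Tetrablock

/-! ### The tetrablock and its distinguished boundary -/

/-- The map `π(A) = (a₁₁, a₂₂, det A)` from `2 × 2` complex matrices to `ℂ³`. -/
def piMap (M : Matrix (Fin 2) (Fin 2) ℂ) : ℂ × ℂ × ℂ := (M 0 0, M 1 1, M.det)

/-- The distinguished boundary `bE` of the tetrablock: the image under `π` of the unitary
matrices. -/
def distinguishedBoundary : Set (ℂ × ℂ × ℂ) :=
  piMap '' {U | U ∈ Matrix.unitaryGroup (Fin 2) ℂ}

/-! ### The Taylor joint spectrum of a commuting triple -/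

section General

variable {X : Type*} [NormedAddCommGroup X] [InnerProductSpace ℂ X] [CompleteSpace X]

/-- Exactness of the Koszul complex `0 → X → X³ → X³ → X → 0` of a triple `(T₁, T₂, T₃)`, whose
maps are `x ↦ (T₁x, T₂x, T₃x)`,
`(x₁, x₂, x₃) ↦ (T₁x₂ - T₂x₁, T₁x₃ - T₃x₁, T₂x₃ - T₃x₂)` and
`(y₁₂, y₁₃, y₂₃) ↦ T₁y₂₃ - T₂y₁₃ + T₃y₁₂`. -/
structure KoszulExact (T₁ T₂ T₃ : X →L[ℂ] X) : Prop where
  exact_zero : ∀ x, T₁ x = 0 → T₂ x = 0 → T₃ x = 0 → x = 0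
  exact_one : ∀ x₁ x₂ x₃,
    T₁ x₂ - T₂ x₁ = 0 → T₁ x₃ - T₃ x₁ = 0 → T₂ x₃ - T₃ x₂ = 0 →
      ∃ x, T₁ x = x₁ ∧ T₂ x = x₂ ∧ T₃ x = x₃
  exact_two : ∀ y₁₂ y₁₃ y₂₃, T₁ y₂₃ - T₂ y₁₃ + T₃ y₁₂ = 0 →
    ∃ x₁ x₂ x₃, T₁ x₂ - T₂ x₁ = y₁₂ ∧ T₁ x₃ - T₃ x₁ = y₁₃ ∧ T₂ x₃ - T₃ x₂ = y₂₃
  exact_three : ∀ x, ∃ y₁₂ y₁₃ y₂₃, T₁ y₂₃ - T₂ y₁₃ + T₃ y₁₂ = x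

/-- The Taylor joint spectrum of a commuting triple: those `(z₁, z₂, z₃)` for which the Koszul
complex of `(T₁ - z₁, T₂ - z₂, T₃ - z₃)` is not exact. -/
def taylorSpectrum (T₁ T₂ T₃ : X →L[ℂ] X) : Set (ℂ × ℂ × ℂ) :=
  {z | ¬ KoszulExact (T₁ - z.1 • ContinuousLinearMap.id ℂ X)
    (T₂ - z.2.1 • ContinuousLinearMap.id ℂ X) (T₃ - z.2.2 • ContinuousLinearMap.id ℂ X)}

/-! ### Tetrablock unitaries, tetrablock isometries and dilations -/

/-- A tetrablock unitary: a triple of commuting bounded normal operators whose joint spectrum is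
contained in the distinguished boundary of the tetrablock. -/
structure IsTetrablockUnitary (N₁ N₂ N₃ : X →L[ℂ] X) : Prop where
  comm₁₂ : N₁ ∘L N₂ = N₂ ∘L N₁
  comm₁₃ : N₁ ∘L N₃ = N₃ ∘L N₁
  comm₂₃ : N₂ ∘L N₃ = N₃ ∘L N₂
  normal₁ : N₁† ∘L N₁ = N₁ ∘L N₁†
  normal₂ : N₂† ∘L N₂ = N₂ ∘L N₂†
  normal₃ : N₃† ∘L N₃ = N₃ ∘L N₃†
  spectrum_subset : taylorSpectrum N₁ N₂ N₃ ⊆ distinguishedBoundary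

/-- A tetrablock isometry: (up to unitary equivalence) the restriction of a tetrablock unitary on
a Hilbert space `L` to a closed joint invariant subspace, namely the range of the isometry `J`. -/
def IsTetrablockIsometry.{u} {K : Type u} [NormedAddCommGroup K] [InnerProductSpace ℂ K]
    [CompleteSpace K] (V₁ V₂ V₃ : K →L[ℂ] K) : Prop :=
  ∃ (L : Type u) (_ : NormedAddCommGroup L) (_ : InnerProductSpace ℂ L) (_ : CompleteSpace L)
    (N₁ N₂ N₃ : L →L[ℂ] L) (J : K →ₗᵢ[ℂ] L), IsTetrablockUnitary N₁ N₂ N₃ ∧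
      (∀ x, N₁ (J x) = J (V₁ x)) ∧ (∀ x, N₂ (J x) = J (V₂ x)) ∧ (∀ x, N₃ (J x) = J (V₃ x))

/-- `(V₁, V₂, V₃)` on `K` is a tetrablock isometric dilation of `(A, B, P)` on `X`, where `X` is
identified with a closed subspace of `K` through the isometry `J`: it is a tetrablock isometry with
`V₁*|_X = A*`, `V₂*|_X = B*`, `V₃*|_X = P*`. -/
structure IsTetrablockIsometricDilation {K : Type*} [NormedAddCommGroup K] [InnerProductSpace ℂ K]
    [CompleteSpace K] (J : X →ₗᵢ[ℂ] K) (A B P : X →L[ℂ] X) (V₁ V₂ V₃ : K →L[ℂ] K) : Prop where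
  isometry : IsTetrablockIsometry V₁ V₂ V₃
  adjoint₁ : ∀ x, (V₁†) (J x) = J ((A†) x)
  adjoint₂ : ∀ x, (V₂†) (J x) = J ((B†) x)
  adjoint₃ : ∀ x, (V₃†) (J x) = J ((P†) x)

/-! ### Defect operators and fundamental operators -/

/-- The defect operator `D_T = (I - T*T)^{1/2}` of a contraction `T`. -/
def defectOp (T : X →L[ℂ] X) : X →L[ℂ] X :=
  CFC.sqrt (ContinuousLinearMap.id ℂ X - T† ∘L T)

theorem defectOp_sq (T : X →L[ℂ] X) (hT : ‖T‖ ≤ 1) :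
    defectOp T ∘L defectOp T = ContinuousLinearMap.id ℂ X - T† ∘L T := by
  have h0 : 0 ≤ ContinuousLinearMap.id ℂ X - T† ∘L T := by
    rw [ContinuousLinearMap.nonneg_iff_isPositive, ContinuousLinearMap.isPositive_def']
    refine ⟨IsSelfAdjoint.sub (IsSelfAdjoint.one _) (IsSelfAdjoint.star_mul_self T), fun x => ?_⟩
    rw [ContinuousLinearMap.reApplyInnerSelf_apply, sub_apply,
      inner_sub_left, ContinuousLinearMap.comp_apply, ContinuousLinearMap.adjoint_inner_left]
    have h1 : ‖T x‖ ≤ ‖x‖ := by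
      simpa using T.le_of_opNorm_le hT x
    simp only [ContinuousLinearMap.id_apply, map_sub, inner_self_eq_norm_sq, sub_nonneg]
    exact pow_le_pow_left₀ (norm_nonneg _) h1 2
  exact CFC.sqrt_mul_sqrt_self _ h0

/-- The defect space `𝒟_T`, the closure of the range of `D_T`. -/
def defectSpace (T : X →L[ℂ] X) : Submodule ℂ X :=
  (LinearMap.range (defectOp T).toLinearMap).topologicalClosure

instance (T : X →L[ℂ] X) : CompleteSpace (defectSpace T) :=
  (Submodule.isClosed_topologicalClosure _).completeSpace_coe

theorem defectOp_mem (T : X →L[ℂ] X) (x : X) : defectOp T x ∈ defectSpace T :=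
  Submodule.le_topologicalClosure _ ⟨x, rfl⟩

/-- `D_T` as an operator from `X` to `𝒟_T`. -/
def defectMap (T : X →L[ℂ] X) : X →L[ℂ] defectSpace T :=
  (defectOp T).codRestrict (defectSpace T) (defectOp_mem T)

/-- `F₁, F₂ ∈ ℬ(𝒟_P)` solve the fundamental equations `A - B*P = D_P F₁ D_P` and
`B - A*P = D_P F₂ D_P` of the triple `(A, B, P)`. -/
structure IsFundamentalPair (A B P : X →L[ℂ] X)
    (F₁ F₂ : defectSpace P →L[ℂ] defectSpace P) : Prop where
  eq₁ : A - B† ∘L P = defectOp P ∘L (defectSpace P).subtypeL ∘L F₁ ∘L defectMap P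
  eq₂ : B - A† ∘L P = defectOp P ∘L (defectSpace P).subtypeL ∘L F₂ ∘L defectMap P

end General

section Sums

variable {X : Type*} [NormedAddCommGroup X] [InnerProductSpace ℂ X]

/-- The operator on `X ⊕ X ⊕ X ⊕ X` with a given `4 × 4` block operator matrix. -/
def blockOp (M : Matrix (Fin 4) (Fin 4) (X →L[ℂ] X)) :
    PiLp 2 (fun _ : Fin 4 => X) →L[ℂ] PiLp 2 (fun _ : Fin 4 => X) :=
  (PiLp.continuousLinearEquiv 2 ℂ (fun _ : Fin 4 => X)).symm.toContinuousLinearMap ∘L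
    ContinuousLinearMap.pi fun i => ∑ j, M i j ∘L PiLp.proj 2 (fun _ : Fin 4 => X) j

theorem blockOp_apply (M : Matrix (Fin 4) (Fin 4) (X →L[ℂ] X)) (x : PiLp 2 (fun _ : Fin 4 => X))
    (i : Fin 4) : blockOp M x i = ∑ j, M i j (x j) := by
  simp [blockOp]

/-- The embedding `h ↦ (h, 0)` of `X` into the Hilbert space direct sum `X ⊕ Y`. -/
def inlIsometry (X Y : Type*) [NormedAddCommGroup X] [InnerProductSpace ℂ X]
    [NormedAddCommGroup Y] [InnerProductSpace ℂ Y] : X →ₗᵢ[ℂ] WithLp 2 (X × Y) where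
  toLinearMap := (WithLp.linearEquiv 2 ℂ (X × Y)).symm.toLinearMap ∘ₗ LinearMap.inl ℂ X Y
  norm_map' x := by
    exact WithLp.norm_toLp_fst 2 X Y x

end Sums

/-! ### The spaces and operators of the family -/

/-- `ℂ²` with the Euclidean norm. -/
abbrev C2 : Type := EuclideanSpace ℂ (Fin 2)

/-- `ℓ²(E)`, the direct sum of countably many copies of `E`. -/
abbrev Ell2 (E : Type*) [NormedAddCommGroup E] : Type _ := lp (fun _ : ℕ => E) 2

/-- `ℋ = ℓ²(ℂ²) ⊕ ℓ²(ℂ²) ⊕ ℓ²(ℂ²) ⊕ ℓ²(ℂ²)`. -/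
abbrev HilbH : Type := PiLp 2 (fun _ : Fin 4 => Ell2 C2)

/-- The sequence `(0, e₀, e₁, …)`. -/
def shiftSeq (f : ℕ → C2) : ℕ → C2
  | 0 => 0
  | n + 1 => f n

theorem hasSum_shiftSeq (f : Ell2 C2) :
    HasSum (fun n => ‖shiftSeq f n‖ ^ (2 : ENNReal).toReal) (‖f‖ ^ (2 : ENNReal).toReal) := by
  rw [← hasSum_nat_add_iff' 1]
  have h := lp.hasSum_norm (p := 2) (by norm_num) f
  simpa [shiftSeq] using h

/-- The unilateral shift `T_z (e₀, e₁, …) = (0, e₀, e₁, …)` on `ℓ²(ℂ²)`. -/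
def shift : Ell2 C2 →ₗᵢ[ℂ] Ell2 C2 where
  toFun f := ⟨shiftSeq f, memℓp_gen (hasSum_shiftSeq f).summable⟩
  map_add' f g := by
    ext1; funext n
    cases n
    · exact (add_zero (0 : C2)).symm
    · rfl
  map_smul' c f := by
    ext1; funext n
    cases n
    · exact (smul_zero c).symm
    · rfl
  norm_map' f := by
    have h := lp.hasSum_norm (p := 2) (by norm_num)
      (⟨shiftSeq f, memℓp_gen (hasSum_shiftSeq f).summable⟩ : Ell2 C2)
    have h' := h.unique (hasSum_shiftSeq f)
    exact (Real.rpow_left_inj (norm_nonneg _) (norm_nonneg _) (by norm_num)).1 h'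

/-- `T_z` as a bounded operator. -/
def Tz : Ell2 C2 →L[ℂ] Ell2 C2 := shift.toContinuousLinearMap

/-- The operator of the matrix `H₁` with rows `(0, α)` and `(0, 0)`. -/
def H₁ (α : ℂ) : C2 →L[ℂ] C2 := Matrix.toEuclideanCLM (𝕜 := ℂ) !![0, α; 0, 0]

/-- `H (c₀, c₁, c₂, …) = (H₁ c₀, 0, 0, …)` on `ℓ²(ℂ²)`. -/
def H (α : ℂ) : Ell2 C2 →L[ℂ] Ell2 C2 :=
  lp.singleContinuousLinearMap ℂ (fun _ : ℕ => C2) 2 0 ∘L H₁ α ∘L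
    lp.evalCLM ℂ (fun _ : ℕ => C2) 2 0

def A (α : ℂ) : HilbH →L[ℂ] HilbH :=
  blockOp !![0, 0, 0, 0;
             0, 0, 0, 0;
             0, 0, H α, 0;
             0, 0, 0, 0]

def B : HilbH →L[ℂ] HilbH := 0

def P : HilbH →L[ℂ] HilbH :=
  blockOp !![0, 0, 0, 0;
             0, 0, 0, 0;
             0, Tz, 0, 0;
             ContinuousLinearMap.id ℂ (Ell2 C2), 0, 0, 0]

/-- The operator `0 ⊕ diag(H*, 0)` on `ℋ = (ℓ²(ℂ²) ⊕ ℓ²(ℂ²)) ⊕ (ℓ²(ℂ²) ⊕ ℓ²(ℂ²))`. -/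
def diagHStar (α : ℂ) : HilbH →L[ℂ] HilbH :=
  blockOp !![0, 0, 0, 0;
             0, 0, 0, 0;
             0, 0, (H α)†, 0;
             0, 0, 0, 0]

theorem H_comp_Tz (α : ℂ) (x : Ell2 C2) : H α (Tz x) = 0 := by
  have h0 : (Tz x : Ell2 C2) 0 = 0 := rfl
  have h1 : lp.evalCLM ℂ (fun _ : ℕ => C2) 2 0 (Tz x) = 0 := h0
  simp [H, h1]

theorem P_apply (x : HilbH) : P x = WithLp.toLp 2 ![0, 0, Tz (x 1), x 0] := by
  ext1 i
  rw [P, blockOp_apply]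
  fin_cases i <;> simp [Fin.sum_univ_four]

theorem diagHStar_apply (α : ℂ) (x : HilbH) :
    diagHStar α x = WithLp.toLp 2 ![0, 0, ((H α)†) (x 2), 0] := by
  ext1 i
  rw [diagHStar, blockOp_apply]
  fin_cases i <;> simp [Fin.sum_univ_four]

theorem P_norm_le (x : HilbH) : ‖P x‖ ≤ ‖x‖ := by
  have h1 := PiLp.norm_sq_eq_of_L2 _ (P x)
  have h2 := PiLp.norm_sq_eq_of_L2 _ x
  have h3 : ‖Tz (x 1)‖ = ‖x 1‖ := shift.norm_map _
  rw [P_apply] at h1 ⊢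
  simp only [Fin.sum_univ_four] at h1 h2
  simp at h1
  rw [h3] at h1
  exact (pow_le_pow_iff_left₀ (norm_nonneg _) (norm_nonneg _) two_ne_zero).1
    (by nlinarith [sq_nonneg ‖x 2‖, sq_nonneg ‖x 3‖])

theorem adjoint_P_diagHStar (α : ℂ) (x : HilbH) : (P†) (diagHStar α x) = 0 := by
  refine ext_inner_right ℂ fun y => ?_
  rw [ContinuousLinearMap.adjoint_inner_left, P_apply, diagHStar_apply, PiLp.inner_apply,
    Fin.sum_univ_four]
  simp [ContinuousLinearMap.adjoint_inner_left, H_comp_Tz]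

theorem defectOp_sq_adjoint_P :
    defectOp (P†) ∘L defectOp (P†) = ContinuousLinearMap.id ℂ HilbH - (P†)† ∘L P† :=
  defectOp_sq _ <| by
    rw [ContinuousLinearMap.adjoint.norm_map]
    exact ContinuousLinearMap.opNorm_le_bound _ zero_le_one fun x => by
      simpa using P_norm_le x

theorem diagHStar_mem (α : ℂ) (x : HilbH) : diagHStar α x ∈ defectSpace (P†) := by
  have h : defectOp (P†) (defectOp (P†) (diagHStar α x)) = diagHStar α x := by
    have := congrArg (fun T => T (diagHStar α x)) defectOp_sq_adjoint_P
    simpa [adjoint_P_diagHStar] using this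
  rw [← h]
  exact defectOp_mem _ _

/-- `G₁ = 0 ⊕ diag(H*, 0)` on `𝒟_{P*}`, the restriction of the operator with this block matrix
on `ℋ`. -/
def G₁ (α : ℂ) : defectSpace (P†) →L[ℂ] defectSpace (P†) :=
  (diagHStar α ∘L (defectSpace (P†)).subtypeL).codRestrict _ fun x => diagHStar_mem α x

def G₂ : defectSpace (P†) →L[ℂ] defectSpace (P†) := 0

/-- The dilation space `ℋ ⊕ 𝒟_{P*} ⊕ 𝒟_{P*} ⊕ ⋯`. -/
abbrev HilbK : Type := WithLp 2 (HilbH × Ell2 (defectSpace (P†)))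

end Tetrablock

end

open Tetrablock

/-! Two facts carry the dilation. First, commuting normal operators with `N₁ = N₂* N₃`, `N₂` a
contraction and `N₃` unitary form a tetrablock unitary: off the distinguished boundary the shifted
triple is jointly bounded below, and by Fuglede's theorem this makes its Koszul complex exact
(`isTetrablockUnitary_of_normal`). If `G² = 0` and `‖Gx‖² + ‖G*x‖² ≤ ‖x‖²`, the Laurent operators
with symbols `G + zG*`, `z(G + zG*)`, `z²` on `ℓ²(ℤ, ℋ)` are of this kind.

Second, take `Q = P*` and `G = A*`. Since `Q² = 0`, the norm identity `‖h‖² = ‖D_Q h‖² + ‖D_Q Q h‖²`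
embeds `ℋ ⊕ ℓ²(𝒟_Q)` isometrically in `ℓ²(ℤ, ℋ)`: the `ℓ²` part fills the indices `≥ 0`, while `D_Q
h` and `D_Q Q h` sit at `-1` and `-3`, two apart because the third symbol is `z²`. The relations `GQ
= G*Q = QG = 0`, together with `D_Q` acting trivially next to `G`, make the Laurent operators
restrict to `W₁`, `W₂`, `W₃` (`isTetrablockIsometry_dilationOp`). The adjoint conditions follow from
triangularity.

The remaining claims rest on `P` being a partial isometry: `D_{P*} = I - PP*` is then a projection,
`𝒟_{P*}` is its fixed space, and the fundamental equations can be read off on that space. -/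

noncomputable section

namespace Tetrablock

/-! ### Koszul exactness, the Taylor spectrum and a criterion for tetrablock unitaries -/

section Spectrum

variable {X : Type*} [NormedAddCommGroup X] [InnerProductSpace ℂ X]

/-- The Koszul complex is exact as soon as the ideal generated by the triple, over a set of
operators commuting with it, contains the identity. -/
theorem koszulExact_of_sum_mul_eq_one {T₁ T₂ T₃ Q₁ Q₂ Q₃ : X →L[ℂ] X}
    (hQ₁ : ∀ T ∈ ({T₁, T₂, T₃} : Set (X →L[ℂ] X)), Commute Q₁ T)
    (hQ₂ : ∀ T ∈ ({T₁, T₂, T₃} : Set (X →L[ℂ] X)), Commute Q₂ T)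
    (hQ₃ : ∀ T ∈ ({T₁, T₂, T₃} : Set (X →L[ℂ] X)), Commute Q₃ T)
    (hsum : Q₁ * T₁ + Q₂ * T₂ + Q₃ * T₃ = 1) : KoszulExact T₁ T₂ T₃ := by
  simp only [Set.mem_insert_iff, Set.mem_singleton_iff, forall_eq_or_imp, forall_eq] at hQ₁ hQ₂ hQ₃
  have key (x : X) : Q₁ (T₁ x) + Q₂ (T₂ x) + Q₃ (T₃ x) = x := DFunLike.congr_fun hsum x
  have comm {S T : X →L[ℂ] X} (h : Commute S T) (x : X) : T (S x) = S (T x) :=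
    (DFunLike.congr_fun h.eq x).symm
  have c₁₁ := comm hQ₁.1; have c₁₂ := comm hQ₁.2.1; have c₁₃ := comm hQ₁.2.2
  have c₂₁ := comm hQ₂.1; have c₂₂ := comm hQ₂.2.1; have c₂₃ := comm hQ₂.2.2
  have c₃₁ := comm hQ₃.1; have c₃₂ := comm hQ₃.2.1; have c₃₃ := comm hQ₃.2.2
  refine ⟨fun x h₁ h₂ h₃ => ?_, fun x₁ x₂ x₃ e₁₂ e₁₃ e₂₃ => ?_, fun y₁₂ y₁₃ y₂₃ e => ?_,
    fun x => ?_⟩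
  · simpa [h₁, h₂, h₃] using (key x).symm
  · rw [sub_eq_zero] at e₁₂ e₁₃ e₂₃
    -- The witnesses in all degrees come from one contracting homotopy, contraction with `(Q₁, Q₂,
    -- Q₃)`.
    refine ⟨Q₁ x₁ + Q₂ x₂ + Q₃ x₃, ?_, ?_, ?_⟩
    · simpa only [map_add, c₁₁, c₂₁, c₃₁, e₁₂, e₁₃] using key x₁
    · simpa only [map_add, c₁₂, c₂₂, c₃₂, ← e₁₂, e₂₃] using key x₂
    · simpa only [map_add, c₁₃, c₂₃, c₃₃, ← e₁₃, ← e₂₃] using key x₃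
  · refine ⟨-(Q₂ y₁₂ + Q₃ y₁₃), Q₁ y₁₂ - Q₃ y₂₃, Q₁ y₁₃ + Q₂ y₂₃, ?_, ?_, ?_⟩
    -- The terms not of the form `Qᵢ Tᵢ y₁₂` collect into `Q₃` of the cocycle relation; the next two
    -- cases use `Q₂` and `Q₁`.
    · have := congrArg Q₃ e
      simp only [map_add, map_sub, map_neg, map_zero, c₁₁, c₃₁, c₂₂, c₃₂] at this ⊢
      linear_combination (norm := module) key y₁₂ - this
    · have := congrArg Q₂ e
      simp only [map_add, map_sub, map_neg, map_zero, c₁₁, c₂₁, c₂₃, c₃₃] at this ⊢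
      linear_combination (norm := module) key y₁₃ + this
    · have := congrArg Q₁ e
      simp only [map_add, map_sub, map_zero, c₁₂, c₂₂, c₁₃, c₃₃] at this ⊢
      linear_combination (norm := module) key y₂₃ - this
  · refine ⟨Q₃ x, -Q₂ x, Q₁ x, ?_⟩
    simp only [map_neg, c₁₁, c₂₂, c₃₃, sub_neg_eq_add]
    exact key x

variable [CompleteSpace X]

/-- The lower bound makes `M = ∑ Tᵢ* Tᵢ` invertible, and by Fuglede's theorem `M` and every `Tᵢ*`
commute with every `Tⱼ`. Hence `Qᵢ = M⁻¹ Tᵢ*` satisfies `∑ Qᵢ Tᵢ = 1`. -/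
theorem koszulExact_of_normal_of_bounded_below {T₁ T₂ T₃ : X →L[ℂ] X}
    (n₁ : IsStarNormal T₁) (n₂ : IsStarNormal T₂) (n₃ : IsStarNormal T₃)
    (h₁₂ : Commute T₁ T₂) (h₁₃ : Commute T₁ T₃) (h₂₃ : Commute T₂ T₃) {δ : ℝ} (hδ : 0 < δ)
    (hb : ∀ x, δ * ‖x‖ ≤ ‖T₁ x‖ + ‖T₂ x‖ + ‖T₃ x‖) : KoszulExact T₁ T₂ T₃ := by
  have s₁₁ : Commute (star T₁) T₁ := n₁.star_comm_self
  have s₂₂ : Commute (star T₂) T₂ := n₂.star_comm_self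
  have s₃₃ : Commute (star T₃) T₃ := n₃.star_comm_self
  have s₁₂ : Commute (star T₁) T₂ := n₁.commute_star_left h₁₂
  have s₁₃ : Commute (star T₁) T₃ := n₁.commute_star_left h₁₃
  have s₂₃ : Commute (star T₂) T₃ := n₂.commute_star_left h₂₃
  have s₂₁ : Commute (star T₂) T₁ := n₂.commute_star_left h₁₂.symm
  have s₃₁ : Commute (star T₃) T₁ := n₃.commute_star_left h₁₃.symm
  have s₃₂ : Commute (star T₃) T₂ := n₃.commute_star_left h₂₃.symm
  set M := star T₁ * T₁ + star T₂ * T₂ + star T₃ * T₃ with hM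
  have hMu : IsUnit M := by
    refine ContinuousLinearMap.isUnit_of_forall_le_norm_inner_map M
      -- The constant comes from `(a + b + c)² ≤ 3(a² + b² + c²)`.
      (c := ⟨δ ^ 2 / 3, by positivity⟩) (show 0 < δ ^ 2 / 3 by positivity) fun x => ?_
    have hin (T : X →L[ℂ] X) : inner ℂ ((star T * T) x) x = (‖T x‖ : ℂ) ^ 2 := by
      rw [ContinuousLinearMap.star_eq_adjoint, mul_apply_eq_comp,
        ContinuousLinearMap.adjoint_inner_left, inner_self_eq_norm_sq_to_K]
      rfl
    have : inner ℂ (M x) x = ((‖T₁ x‖ ^ 2 + ‖T₂ x‖ ^ 2 + ‖T₃ x‖ ^ 2 : ℝ) : ℂ) := by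
      rw [hM, add_apply, add_apply, inner_add_left,
        inner_add_left, hin, hin, hin]
      push_cast; rfl
    rw [this, Complex.norm_real, Real.norm_eq_abs, abs_of_nonneg (by positivity)]
    have h2 := pow_le_pow_left₀ (by positivity) (hb x) 2
    change ‖x‖ ^ 2 * (δ ^ 2 / 3) ≤ _
    nlinarith [sq_nonneg (‖T₁ x‖ - ‖T₂ x‖), sq_nonneg (‖T₁ x‖ - ‖T₃ x‖),
      sq_nonneg (‖T₂ x‖ - ‖T₃ x‖)]
  obtain ⟨u, hu⟩ := hMu
  have hMT (T : X →L[ℂ] X) (a₁ : Commute (star T₁) T) (b₁ : Commute T₁ T)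
      (a₂ : Commute (star T₂) T) (b₂ : Commute T₂ T) (a₃ : Commute (star T₃) T)
      (b₃ : Commute T₃ T) : Commute (↑u⁻¹ : X →L[ℂ] X) T := by
    refine Commute.units_inv_left ?_
    rw [hu]
    exact ((a₁.mul_left b₁).add_left (a₂.mul_left b₂)).add_left (a₃.mul_left b₃)
  have m₁ := hMT T₁ s₁₁ (.refl _) s₂₁ h₁₂.symm s₃₁ h₁₃.symm
  have m₂ := hMT T₂ s₁₂ h₁₂ s₂₂ (.refl _) s₃₂ h₂₃.symm
  have m₃ := hMT T₃ s₁₃ h₁₃ s₂₃ h₂₃ s₃₃ (.refl _)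
  refine koszulExact_of_sum_mul_eq_one (Q₁ := ↑u⁻¹ * star T₁) (Q₂ := ↑u⁻¹ * star T₂)
    (Q₃ := ↑u⁻¹ * star T₃) ?_ ?_ ?_ ?_
  · simp only [Set.mem_insert_iff, Set.mem_singleton_iff, forall_eq_or_imp, forall_eq]
    exact ⟨m₁.mul_left s₁₁, m₂.mul_left s₁₂, m₃.mul_left s₁₃⟩
  · simp only [Set.mem_insert_iff, Set.mem_singleton_iff, forall_eq_or_imp, forall_eq]
    exact ⟨m₁.mul_left s₂₁, m₂.mul_left s₂₂, m₃.mul_left s₂₃⟩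
  · simp only [Set.mem_insert_iff, Set.mem_singleton_iff, forall_eq_or_imp, forall_eq]
    exact ⟨m₁.mul_left s₃₁, m₂.mul_left s₃₂, m₃.mul_left s₃₃⟩
  · rw [mul_assoc, mul_assoc, mul_assoc, ← mul_add, ← mul_add, ← hM, ← hu, Units.inv_mul]

/-- With `w = √(1 - |b|²)`, the matrix with rows `(b̄p, w)` and `(-wp, b)` is unitary of determinant
`(|b|² + w²)p = p`. -/
theorem mem_distinguishedBoundary {a b p : ℂ} (hp : ‖p‖ = 1) (hb : ‖b‖ ≤ 1)
    (hab : a = star b * p) : (a, b, p) ∈ distinguishedBoundary := by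
  set w : ℂ := ((Real.sqrt (1 - ‖b‖ ^ 2) : ℝ) : ℂ) with hw
  have hww : w * w = 1 - b * star b := by
    rw [hw, ← Complex.ofReal_mul, Real.mul_self_sqrt (by nlinarith [norm_nonneg b])]
    simp [Complex.mul_conj, Complex.normSq_eq_norm_sq]
  have hws : star w = w := Complex.conj_ofReal _
  have hpp : p * star p = 1 := by
    simp [Complex.mul_conj, Complex.normSq_eq_norm_sq, hp]
  refine ⟨!![a, w; -(w * p), b], ?_, ?_⟩
  · rw [Set.mem_ofPred_eq, Matrix.mem_unitaryGroup_iff]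
    ext i j
    simp only [Matrix.star_eq_conjTranspose]
    fin_cases i <;> fin_cases j <;>
      simp only [Matrix.mul_apply, Fin.sum_univ_two, Matrix.conjTranspose_apply, Fin.zero_eta,
        Fin.mk_one, Matrix.of_apply, Matrix.cons_val', Matrix.cons_val_zero, Matrix.cons_val_one,
        Matrix.cons_val_fin_one, hab, star_mul', star_neg, star_star, hws, Matrix.one_apply_eq,
        Matrix.one_apply, Fin.isValue, zero_ne_one, one_ne_zero, if_false]
    · linear_combination hww + b * star b * hpp
    · linear_combination (-(star b) * w) * hpp
    · linear_combination (-(w * b)) * hpp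
    · linear_combination hww + w * w * hpp
  · simp only [piMap, Matrix.det_fin_two_of, hab, Prod.mk.injEq]
    refine ⟨rfl, rfl, ?_⟩
    linear_combination p * hww

/-- Commuting normal operators `N₁ = N₂* N₃`, with `N₂` a contraction and `N₃` unitary, form a
tetrablock unitary. -/
theorem isTetrablockUnitary_of_normal {N₁ N₂ N₃ : X →L[ℂ] X}
    (n₁ : IsStarNormal N₁) (n₂ : IsStarNormal N₂) (n₃ : IsStarNormal N₃)
    (h₁₂ : Commute N₁ N₂) (h₁₃ : Commute N₁ N₃) (h₂₃ : Commute N₂ N₃)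
    (hN : N₁ = star N₂ * N₃) (hN₂ : ∀ x, ‖N₂ x‖ ≤ ‖x‖) (hN₃ : ∀ x, ‖N₃ x‖ = ‖x‖) :
    IsTetrablockUnitary N₁ N₂ N₃ where
  comm₁₂ := h₁₂
  comm₁₃ := h₁₃
  comm₂₃ := h₂₃
  normal₁ := n₁.star_comm_self
  normal₂ := n₂.star_comm_self
  normal₃ := n₃.star_comm_self
  spectrum_subset := by
    rintro ⟨a, b, p⟩ hz
    by_contra hbE
    refine hz ?_
    have nsub {N : X →L[ℂ] X} (hN : IsStarNormal N) (c : ℂ) :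
        IsStarNormal (N - c • (1 : X →L[ℂ] X)) := by
      refine ⟨?_⟩
      have := hN.star_comm_self
      simp only [star_sub, star_smul, star_one]
      exact ((this.sub_left ((Commute.one_left _).smul_left _)).sub_right
        ((Commute.one_right _).smul_right _))
    have csub {S T : X →L[ℂ] X} (h : Commute S T) (c d : ℂ) :
        Commute (S - c • (1 : X →L[ℂ] X)) (T - d • (1 : X →L[ℂ] X)) :=
      (h.sub_left ((Commute.one_left _).smul_left _)).sub_right
        ((Commute.one_right _).smul_right _)
    have happ (N : X →L[ℂ] X) (c : ℂ) (x : X) : (N - c • (1 : X →L[ℂ] X)) x = N x - c • x := rfl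
    -- A point off the boundary violates `|p| = 1`, `|b| ≤ 1` or `a = b̄p`; each violation yields
    -- its own lower bound.
    suffices ∃ δ > 0, ∀ x, δ * ‖x‖ ≤ ‖N₁ x - a • x‖ + ‖N₂ x - b • x‖ + ‖N₃ x - p • x‖ by
      obtain ⟨δ, hδ, hx⟩ := this
      exact koszulExact_of_normal_of_bounded_below (nsub n₁ a) (nsub n₂ b) (nsub n₃ p)
        (csub h₁₂ _ _) (csub h₁₃ _ _) (csub h₂₃ _ _) hδ hx
    by_cases hp : ‖p‖ = 1
    swap
    · refine ⟨|1 - ‖p‖|, abs_pos.2 (sub_ne_zero.2 (Ne.symm hp)), fun x => ?_⟩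
      have := abs_norm_sub_norm_le (N₃ x) (p • x)
      rw [hN₃, norm_smul, ← one_sub_mul, abs_mul, abs_norm] at this
      linarith [norm_nonneg (N₁ x - a • x), norm_nonneg (N₂ x - b • x)]
    by_cases hb : ‖b‖ ≤ 1
    swap
    · refine ⟨‖b‖ - 1, by linarith, fun x => ?_⟩
      have := norm_sub_norm_le (b • x) (N₂ x)
      rw [norm_smul, norm_sub_rev] at this
      linarith [norm_nonneg (N₁ x - a • x), norm_nonneg (N₃ x - p • x), hN₂ x]
    have hab : a - star b * p ≠ 0 := fun h =>
      hbE (mem_distinguishedBoundary hp hb (sub_eq_zero.1 h))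
    refine ⟨‖a - star b * p‖, norm_pos_iff.2 hab, fun x => ?_⟩
    have h₁ : ‖star N₂ (N₃ x - p • x)‖ ≤ ‖N₃ x - p • x‖ := by
      rw [ContinuousLinearMap.star_eq_adjoint,
        ← ContinuousLinearMap.isStarNormal_iff_norm_eq_adjoint.1 n₂]
      exact hN₂ _
    have h₂ : ‖star N₂ x - star b • x‖ = ‖N₂ x - b • x‖ := by
      have := ContinuousLinearMap.isStarNormal_iff_norm_eq_adjoint.1 (nsub n₂ b) x
      rw [← ContinuousLinearMap.star_eq_adjoint, star_sub, star_smul, star_one, happ, happ] at this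
      exact this.symm
    -- The scalar defect is written through the three shifted operators using `N₁ = N₂* N₃`.
    -- Normality of `N₂ - b` then trades `N₂* - b̄` for `N₂ - b` in norm.
    have h₃ : (a - star b * p) • x = -(N₁ x - a • x) + star N₂ (N₃ x - p • x)
        + p • (star N₂ x - star b • x) := by
      have : N₁ x = star N₂ (N₃ x) := by rw [hN]; rfl
      rw [this, map_sub, map_smul, sub_smul, smul_sub, smul_smul, mul_comm p]
      abel
    rw [← norm_smul, h₃]
    refine (norm_add₃_le ..).trans ?_
    rw [norm_neg, norm_smul, hp, one_mul, h₂]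
    linarith

/-- The triple `(G + U G*, U (G + U G*), U²)` attached to a unitary `U` and a square-zero operator
`G` commuting with it. -/
theorem isTetrablockUnitary_of_sq_eq_zero {G U : X →L[ℂ] X} (hGU : Commute G U)
    (hU : star U * U = 1) (hU' : U * star U = 1) (hG : G * G = 0)
    (hle : ∀ x, ‖G x‖ ^ 2 + ‖star G x‖ ^ 2 ≤ ‖x‖ ^ 2) :
    IsTetrablockUnitary (G + U * star G) (U * (G + U * star G)) (U * U) := by
  have nU : IsStarNormal U := ⟨hU.trans hU'.symm⟩
  have c₁ : Commute (star U) G := nU.commute_star_left hGU.symm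
  have c₂ : Commute (star G) U := by
    have := congrArg star c₁.eq
    rwa [star_mul, star_mul, star_star] at this
  have hG' : star G * star G = 0 := by rw [← star_mul, hG, star_zero]
  have cU : Commute (G + U * star G) U := hGU.add_left ((Commute.refl U).mul_left c₂)
  have nN : IsStarNormal (G + U * star G) := by
    refine ⟨?_⟩
    -- The cross terms contain `G²` or `G*²`, so both products reduce to `G*G + GG*`.
    have e₁ : star (G + U * star G) * (G + U * star G) = star G * G + G * star G := by
      have h₁ : star G * (U * star G) = 0 := by rw [← mul_assoc, c₂.eq, mul_assoc, hG', mul_zero]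
      have h₂ : G * star U * G = 0 := by rw [mul_assoc, c₁.eq, ← mul_assoc, hG, zero_mul]
      have h₃ : G * star U * (U * star G) = G * star G := by
        rw [mul_assoc, ← mul_assoc (star U), hU, one_mul]
      rw [star_add, star_mul, star_star, add_mul, mul_add, mul_add, h₁, h₂, h₃, add_zero, zero_add]
    have e₂ : (G + U * star G) * star (G + U * star G) = G * star G + star G * G := by
      have h₁ : G * (G * star U) = 0 := by rw [← mul_assoc, hG, zero_mul]
      have h₂ : U * star G * star G = 0 := by rw [mul_assoc, hG', mul_zero]
      have h₃ : U * star G * (G * star U) = star G * G := by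
        rw [← c₂.eq, mul_assoc, ← mul_assoc U, ← hGU.eq, mul_assoc G, hU', mul_one]
      rw [star_add, star_mul, star_star, add_mul, mul_add, mul_add, h₁, h₂, h₃, add_zero, zero_add]
    rw [Commute, SemiconjBy, e₁, e₂, add_comm]
  have cUs : Commute (star U) (G + U * star G) := nU.commute_star_left cU.symm
  have hUn (x : X) : ‖U x‖ = ‖x‖ := (ContinuousLinearMap.norm_map_iff_adjoint_comp_self U).2 hU x
  have hN : ∀ x, ‖(G + U * star G) x‖ ≤ ‖x‖ := fun x => by
    -- Moving `G*` across the inner product produces `G²x = 0`, so the two summands are orthogonal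
    -- and the hypothesis on `G` gives contractivity.
    have horth : inner ℂ (G x) (U (star G x)) = 0 := by
      have h₁ : U (star G x) = star G (U x) := (DFunLike.congr_fun c₂.eq x).symm
      have h₂ : G (G x) = 0 := DFunLike.congr_fun hG x
      rw [h₁, ContinuousLinearMap.star_eq_adjoint, ContinuousLinearMap.adjoint_inner_right, h₂,
        inner_zero_left]
    have := norm_add_sq_eq_norm_sq_add_norm_sq_of_inner_eq_zero _ _ horth
    refine (pow_le_pow_iff_left₀ (norm_nonneg _) (norm_nonneg _) two_ne_zero).1 ?_
    calc ‖(G + U * star G) x‖ ^ 2 = ‖G x‖ ^ 2 + ‖star G x‖ ^ 2 := by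
          rw [← hUn (star G x), sq, sq, sq]; exact this
      _ ≤ ‖x‖ ^ 2 := hle x
  refine isTetrablockUnitary_of_normal nN ⟨?_⟩ ⟨?_⟩ (cU.mul_right (.refl _)) (cU.mul_right cU)
    ((Commute.refl U |>.mul_left cU).mul_right (Commute.refl U |>.mul_left cU)) ?_ ?_ ?_
  · rw [star_mul]
    exact ((nN.commute_star_left cU).mul_left nU.star_comm_self).mul_right
      (nN.star_comm_self.mul_left cUs)
  · rw [star_mul]
    exact (nU.star_comm_self.mul_left nU.star_comm_self).mul_right
      (nU.star_comm_self.mul_left nU.star_comm_self)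
  -- With `N = G + UG*`, the identity `N*U = N` yields `(UN)* U² = N`.
  · have : star (G + U * star G) * U = G + U * star G := by
      rw [star_add, star_mul, star_star, add_mul, mul_assoc, hU, mul_one, c₂.eq, add_comm]
    rw [star_mul, mul_assoc, ← mul_assoc (star U), hU, one_mul, this]
  · intro x
    rw [mul_apply_eq_comp, hUn]
    exact hN x
  · intro x
    rw [mul_apply_eq_comp, hUn, hUn]

end Spectrum

/-! ### Diagonal operators and shifts on `ℓ²` spaces, Laurent operators, defect operators -/

section Ell2Operators

variable {ι κ : Type*} {E F : Type*} [NormedAddCommGroup E] [InnerProductSpace ℂ E]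
  [NormedAddCommGroup F] [InnerProductSpace ℂ F]

/-- The diagonal operator `(eᵢ) ↦ (T eᵢ)` between `ℓ²` spaces. -/
def ellMap (T : E →L[ℂ] F) : lp (fun _ : ι => E) 2 →L[ℂ] lp (fun _ : ι => F) 2 :=
  lp.mapCLM 2 (fun _ => T) (norm_nonneg T) fun _ => le_rfl

@[simp]
theorem ellMap_apply (T : E →L[ℂ] F) (f : lp (fun _ : ι => E) 2) (i : ι) :
    ellMap T f i = T (f i) := rfl

@[simp]
theorem ellMap_single [DecidableEq ι] (T : E →L[ℂ] F) (i : ι) (a : E) :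
    ellMap T (lp.single 2 i a) = lp.single 2 i (T a) := by
  ext1; funext j
  by_cases h : j = i
  · subst h; simp
  · simp [h]

theorem adjoint_ellMap [CompleteSpace E] [CompleteSpace F] (T : E →L[ℂ] F) :
    (ellMap (ι := ι) T)† = ellMap (T†) := by
  refine ((ContinuousLinearMap.eq_adjoint_iff _ _).2 fun f g => ?_).symm
  simp only [lp.inner_eq_tsum, ellMap_apply, ContinuousLinearMap.adjoint_inner_left]

theorem hasSum_norm_extend {E : Type*} [NormedAddCommGroup E] (e : ι ↪ κ)
    (f : lp (fun _ : ι => E) 2) :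
    HasSum (fun k => ‖Function.extend e f 0 k‖ ^ (2 : ENNReal).toReal)
      (‖f‖ ^ (2 : ENNReal).toReal) := by
  have h := lp.hasSum_norm (p := 2) (by norm_num) f
  refine (e.injective.hasSum_iff fun k hk => ?_).1 ?_
  · rw [Function.extend_apply' _ _ _ (by simpa using hk)]
    simp
  · simpa [Function.comp_def, e.injective.extend_apply] using h

/-- Relabelling of the coordinates along an injection, with zeros off its range, as an isometry
of `ℓ²` spaces. -/
def ellExtend (e : ι ↪ κ) : lp (fun _ : ι => E) 2 →ₗᵢ[ℂ] lp (fun _ : κ => E) 2 where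
  toFun f := ⟨Function.extend e f 0, memℓp_gen (hasSum_norm_extend e f).summable⟩
  map_add' f g := by
    ext1
    have := Function.extend_add e (f : ι → E) g 0 0
    rwa [add_zero] at this
  map_smul' c f := by
    ext1
    have := Function.extend_smul c e (f : ι → E) 0
    rwa [smul_zero] at this
  norm_map' f := by
    have h := (lp.hasSum_norm (p := 2) (by norm_num)
      (⟨Function.extend e f 0, memℓp_gen (hasSum_norm_extend e f).summable⟩ :
        lp (fun _ : κ => E) 2)).unique (hasSum_norm_extend e f)
    exact (Real.rpow_left_inj (norm_nonneg _) (norm_nonneg _) (by norm_num)).1 h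

@[simp]
theorem ellExtend_apply (e : ι ↪ κ) (f : lp (fun _ : ι => E) 2) (i : ι) :
    ellExtend e f (e i) = f i :=
  e.injective.extend_apply _ _ _

theorem ellExtend_apply_of_notMem (e : ι ↪ κ) (f : lp (fun _ : ι => E) 2) {k : κ}
    (hk : k ∉ Set.range e) : ellExtend e f k = 0 :=
  Function.extend_apply' _ _ _ (by simpa using hk)

theorem ellMap_ellExtend (T : E →L[ℂ] F) (e : ι ↪ κ) (f : lp (fun _ : ι => E) 2) :
    ellMap T (ellExtend e f) = ellExtend e (ellMap T f) := by
  ext1; funext k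
  by_cases hk : k ∈ Set.range e
  · obtain ⟨i, rfl⟩ := hk; simp
  · simp [ellExtend_apply_of_notMem e _ hk]

@[simp]
theorem ellExtend_single [DecidableEq ι] [DecidableEq κ] (e : ι ↪ κ) (i : ι) (a : E) :
    ellExtend e (lp.single 2 i a) = lp.single 2 (e i) a := by
  ext1; funext k
  by_cases hk : k ∈ Set.range e
  · obtain ⟨j, rfl⟩ := hk
    by_cases h : j = i
    · subst h; simp
    · simp [h]
  · rw [ellExtend_apply_of_notMem e _ hk, lp.single_apply_ne]
    rintro rfl; exact hk ⟨i, rfl⟩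

theorem ellExtend_ellExtend {ν : Type*} (e : ι ↪ κ) (e' : κ ↪ ν) (f : lp (fun _ : ι => E) 2) :
    ellExtend e' (ellExtend e f) = ellExtend (e.trans e') f := by
  ext1; funext k
  by_cases hk : k ∈ Set.range (e.trans e')
  · obtain ⟨i, rfl⟩ := hk
    rw [ellExtend_apply, Function.Embedding.trans_apply, ellExtend_apply, ellExtend_apply]
  · rw [ellExtend_apply_of_notMem _ _ hk]
    by_cases hk' : k ∈ Set.range e'
    · obtain ⟨j, rfl⟩ := hk'
      rw [ellExtend_apply, ellExtend_apply_of_notMem]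
      rintro ⟨i, rfl⟩; exact hk ⟨i, rfl⟩
    · rw [ellExtend_apply_of_notMem _ _ hk']

/-- The unilateral shift on `ℓ²(E)`. -/
def unilateralShift (E : Type*) [NormedAddCommGroup E] [InnerProductSpace ℂ E] :
    Ell2 E →L[ℂ] Ell2 E :=
  (ellExtend ⟨Nat.succ, Nat.succ_injective⟩).toContinuousLinearMap

@[simp]
theorem unilateralShift_apply_zero (f : Ell2 E) : unilateralShift E f 0 = 0 :=
  ellExtend_apply_of_notMem _ f (by simp)

@[simp]
theorem unilateralShift_apply_succ (f : Ell2 E) (n : ℕ) : unilateralShift E f (n + 1) = f n :=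
  ellExtend_apply ⟨Nat.succ, Nat.succ_injective⟩ f n

@[simp]
theorem unilateralShift_apply_one (f : Ell2 E) : unilateralShift E f 1 = f 0 :=
  unilateralShift_apply_succ f 0

/-- The bilateral shift on `ℓ²(ℤ, E)`. -/
def bilateralShift (E : Type*) [NormedAddCommGroup E] [InnerProductSpace ℂ E] :
    lp (fun _ : ℤ => E) 2 →L[ℂ] lp (fun _ : ℤ => E) 2 :=
  (ellExtend (Equiv.addRight (1 : ℤ)).toEmbedding).toContinuousLinearMap

@[simp]
theorem bilateralShift_single (n : ℤ) (a : E) :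
    bilateralShift E (lp.single 2 n a) = lp.single 2 (n + 1) a :=
  ellExtend_single (Equiv.addRight (1 : ℤ)).toEmbedding n a

theorem star_bilateralShift_mul_self [CompleteSpace E] :
    star (bilateralShift E) * bilateralShift E = 1 :=
  (ContinuousLinearMap.norm_map_iff_adjoint_comp_self _).1 fun f =>
    (ellExtend (Equiv.addRight (1 : ℤ)).toEmbedding).norm_map f

/-- The backward relabelling is a right inverse, as seen on single coordinates; an isometry with a
right inverse is unitary. -/
theorem bilateralShift_mul_star_self [CompleteSpace E] :
    bilateralShift E * star (bilateralShift E) = 1 := by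
  set V : lp (fun _ : ℤ => E) 2 →L[ℂ] lp (fun _ : ℤ => E) 2 :=
    (ellExtend (Equiv.addRight (1 : ℤ)).symm.toEmbedding).toContinuousLinearMap with hV
  have h : bilateralShift E * V = 1 := by
    refine lp.ext_continuousLinearMap (by norm_num) fun i => ?_
    ext1 a
    have h₁ : V (lp.single 2 i a) = lp.single 2 (i - 1) a :=
      ellExtend_single (Equiv.addRight (1 : ℤ)).symm.toEmbedding i a
    change bilateralShift E (V (lp.single 2 i a)) = lp.single 2 i a
    rw [h₁, bilateralShift_single, sub_add_cancel]
  have h' : star (bilateralShift E) = V := by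
    rw [← mul_one (star _), ← h, ← mul_assoc, star_bilateralShift_mul_self, one_mul]
  rw [h', h]

theorem commute_ellMap_bilateralShift (T : E →L[ℂ] E) :
    Commute (ellMap T) (bilateralShift E) :=
  ContinuousLinearMap.ext fun f => ellMap_ellExtend T _ f

theorem norm_sq_ellMap_add_le {G : Type*} [NormedAddCommGroup G] [InnerProductSpace ℂ G]
    {S : E →L[ℂ] F} {T : E →L[ℂ] G} (h : ∀ x, ‖S x‖ ^ 2 + ‖T x‖ ^ 2 ≤ ‖x‖ ^ 2)
    (f : lp (fun _ : ι => E) 2) : ‖ellMap S f‖ ^ 2 + ‖ellMap T f‖ ^ 2 ≤ ‖f‖ ^ 2 := by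
  have h₀ := lp.hasSum_norm (p := 2) (by norm_num) f
  have h₁ := lp.hasSum_norm (p := 2) (by norm_num) (ellMap S f)
  have h₂ := lp.hasSum_norm (p := 2) (by norm_num) (ellMap T f)
  simp only [ENNReal.toReal_ofNat, Real.rpow_ofNat] at h₀ h₁ h₂
  exact hasSum_le (fun n => h (f n)) (h₁.add h₂) h₀

theorem norm_sq_add_single_add_single [DecidableEq ι] (f : lp (fun _ : ι => E) 2) {i j : ι}
    (hij : i ≠ j) (hi : f i = 0) (hj : f j = 0) (a b : E) :
    ‖f + lp.single 2 i a + lp.single 2 j b‖ ^ 2 = ‖f‖ ^ 2 + ‖a‖ ^ 2 + ‖b‖ ^ 2 := by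
  have h₁ : inner ℂ f (lp.single 2 i a) = 0 := by
    rw [lp.inner_single_right, hi, inner_zero_left]
  have h₂ : inner ℂ (f + lp.single 2 i a) (lp.single 2 j b) = 0 := by
    rw [lp.inner_single_right, lp.coeFn_add, Pi.add_apply, hj, lp.single_apply_ne _ _ _ hij.symm,
      add_zero, inner_zero_left]
  have e₁ := norm_add_sq_eq_norm_sq_add_norm_sq_of_inner_eq_zero _ _ h₁
  have e₂ := norm_add_sq_eq_norm_sq_add_norm_sq_of_inner_eq_zero _ _ h₂
  rw [lp.norm_single (by norm_num)] at e₁ e₂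
  linarith

/-- On `ℓ²(ℤ, E)`, the Laurent operators with symbols `G + z G*`, `z (G + z G*)` and `z²` form a
tetrablock unitary. -/
theorem isTetrablockUnitary_laurent [CompleteSpace E] {G : E →L[ℂ] E} (hG : ∀ x, G (G x) = 0)
    (hle : ∀ x, ‖G x‖ ^ 2 + ‖(G†) x‖ ^ 2 ≤ ‖x‖ ^ 2) :
    IsTetrablockUnitary (ellMap G + bilateralShift E * ellMap (G†))
      (bilateralShift E * (ellMap G + bilateralShift E * ellMap (G†)))
      (bilateralShift E * bilateralShift E) := by
  have hs : star (ellMap (ι := ℤ) G) = ellMap (G†) := adjoint_ellMap G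
  have h := isTetrablockUnitary_of_sq_eq_zero (commute_ellMap_bilateralShift G)
    star_bilateralShift_mul_self bilateralShift_mul_star_self
    (ContinuousLinearMap.ext fun f => lp.ext (funext fun n => hG (f n)))
    (by rw [hs]; exact norm_sq_ellMap_add_le hle)
  rwa [hs] at h

/-- The inclusion of `ℓ²(S)` in `ℓ²(ℤ, E)`, for a subspace `S` of `E`. -/
def ellIncl (S : Submodule ℂ E) : Ell2 S →ₗᵢ[ℂ] lp (fun _ : ℤ => E) 2 where
  toLinearMap := (ellExtend ⟨Nat.cast, Nat.cast_injective⟩).toLinearMap ∘ₗ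
    (ellMap S.subtypeL).toLinearMap
  norm_map' f := by
    change ‖ellExtend ⟨Nat.cast, Nat.cast_injective⟩ (ellMap S.subtypeL f)‖ = ‖f‖
    rw [LinearIsometry.norm_map]
    have h₁ := lp.hasSum_norm (p := 2) (by norm_num) (ellMap S.subtypeL f)
    have h₂ := lp.hasSum_norm (p := 2) (by norm_num) f
    exact (Real.rpow_left_inj (norm_nonneg _) (norm_nonneg _) (by norm_num)).1 (h₁.unique h₂)

theorem ellIncl_apply (S : Submodule ℂ E) (f : Ell2 S) :
    ellIncl S f = ellExtend ⟨Nat.cast, Nat.cast_injective⟩ (ellMap S.subtypeL f) := rfl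

@[simp]
theorem ellIncl_single (S : Submodule ℂ E) (n : ℕ) (d : S) :
    ellIncl S (lp.single 2 n d) = lp.single 2 (n : ℤ) (d : E) := by
  rw [ellIncl_apply, ellMap_single, ellExtend_single]; rfl

theorem ellIncl_apply_neg (S : Submodule ℂ E) (f : Ell2 S) {n : ℤ} (hn : n < 0) :
    ellIncl S f n = 0 :=
  ellExtend_apply_of_notMem _ _ (by rintro ⟨m, rfl⟩; exact absurd hn (by simp))

theorem bilateralShift_ellIncl (S : Submodule ℂ E) (f : Ell2 S) :
    bilateralShift E (ellIncl S f) = ellIncl S (unilateralShift S f) := by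
  change ellExtend _ (ellExtend _ _) = ellExtend _ (ellMap _ (ellExtend _ _))
  rw [ellMap_ellExtend, ellExtend_ellExtend, ellExtend_ellExtend]
  congr 1

theorem ellMap_ellIncl (S : Submodule ℂ E) {T : E →L[ℂ] E} {T' : S →L[ℂ] S}
    (h : ∀ d, (T' d : E) = T d) (f : Ell2 S) :
    ellMap T (ellIncl S f) = ellIncl S (ellMap T' f) := by
  rw [ellIncl_apply, ellIncl_apply, ellMap_ellExtend]
  congr 1
  ext1; funext n
  exact (h (f n)).symm

theorem bilateralShift_ellIncl_add (S : Submodule ℂ E) (f : Ell2 S) (m n : ℤ) (a b : E) :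
    bilateralShift E (ellIncl S f + lp.single 2 m a + lp.single 2 n b) =
      ellIncl S (unilateralShift S f) + lp.single 2 (m + 1) a + lp.single 2 (n + 1) b := by
  rw [map_add, map_add, bilateralShift_ellIncl, bilateralShift_single, bilateralShift_single]

/-- This is the shape of an embedded dilation vector: an `ℓ²(S)` part and two extra coordinates, the
second one annihilated by both coefficients of the symbol. -/
theorem laurent_ellIncl_add (S : Submodule ℂ E) {G G' : E →L[ℂ] E} {K K' : S →L[ℂ] S}
    (hK : ∀ d, (K d : E) = G d) (hK' : ∀ d, (K' d : E) = G' d) (f : Ell2 S) (a : E) {b : E}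
    (hb : G b = 0) (hb' : G' b = 0) (m n : ℤ) :
    (ellMap (ι := ℤ) G + bilateralShift E * ellMap G' :
        lp (fun _ : ℤ => E) 2 →L[ℂ] lp (fun _ : ℤ => E) 2)
        (ellIncl S f + lp.single 2 m a + lp.single 2 n b) =
      ellIncl S (ellMap K f + unilateralShift S (ellMap K' f)) + lp.single 2 m (G a) +
        lp.single 2 (m + 1) (G' a) := by
  simp only [add_apply, mul_apply_eq_comp, map_add, ellMap_ellIncl S hK, ellMap_ellIncl S hK',
    ellMap_single, hb, hb', lp.single_zero, map_zero, add_zero, bilateralShift_ellIncl,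
    bilateralShift_single]
  abel

theorem norm_sq_defectOp {X : Type*} [NormedAddCommGroup X] [InnerProductSpace ℂ X]
    [CompleteSpace X] {T : X →L[ℂ] X} (hT : ‖T‖ ≤ 1) (x : X) :
    ‖defectOp T x‖ ^ 2 = ‖x‖ ^ 2 - ‖T x‖ ^ 2 := by
  have hs : IsSelfAdjoint (defectOp T) := (CFC.sqrt_nonneg _).isSelfAdjoint
  have h : inner ℂ (defectOp T x) (defectOp T x) = inner ℂ x x - inner ℂ (T x) (T x) := by
    have e : defectOp T (defectOp T x) = x - (T†) (T x) :=
      DFunLike.congr_fun (defectOp_sq T hT) x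
    rw [← ContinuousLinearMap.adjoint_inner_right, ← ContinuousLinearMap.star_eq_adjoint, hs.star_eq,
      e, inner_sub_right, ContinuousLinearMap.adjoint_inner_right]
  rw [inner_self_eq_norm_sq_to_K, inner_self_eq_norm_sq_to_K, inner_self_eq_norm_sq_to_K] at h
  exact_mod_cast h

/-- An orthogonal projection is positive, as `D = D*D`, and is its own square root. -/
theorem defectOp_eq_of_mul_self_eq {X : Type*} [NormedAddCommGroup X] [InnerProductSpace ℂ X]
    [CompleteSpace X] {T D : X →L[ℂ] X} (hD : D = 1 - T† * T) (hDD : ∀ x, D (D x) = D x) :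
    defectOp T = D := by
  have hs : star D = D := by
    rw [hD, ← ContinuousLinearMap.star_eq_adjoint]; simp
  have hm : D * D = D := ContinuousLinearMap.ext hDD
  refine CFC.sqrt_unique (hm.trans hD) ?_
  rw [← hm]
  nth_rw 1 [← hs]
  exact star_mul_self_nonneg _

end Ell2Operators

/-! ### Adjoints and vanishing products for the concrete operators -/

section Family

theorem adjoint_Tz_Tz (x : Ell2 C2) : (Tz†) (Tz x) = x :=
  DFunLike.congr_fun
    ((ContinuousLinearMap.norm_map_iff_adjoint_comp_self Tz).1 shift.norm_map) x

theorem H_apply (α : ℂ) (x : Ell2 C2) : H α x = lp.single 2 0 (H₁ α (x 0)) := rfl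

theorem adjoint_H_apply (α : ℂ) (x : Ell2 C2) :
    ((H α)†) x = lp.single 2 0 (((H₁ α)†) (x 0)) := by
  refine ext_inner_right ℂ fun y => ?_
  rw [ContinuousLinearMap.adjoint_inner_left, H_apply, lp.inner_single_right,
    lp.inner_single_left, ContinuousLinearMap.adjoint_inner_left]

theorem adjoint_Tz_single (a : C2) : (Tz†) (lp.single 2 0 a) = 0 := by
  refine ext_inner_right ℂ fun y => ?_
  have h : (Tz y : Ell2 C2) 0 = 0 := rfl
  rw [ContinuousLinearMap.adjoint_inner_left, lp.inner_single_left, h, inner_zero_right,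
    inner_zero_left]

theorem adjoint_Tz_H (α : ℂ) (x : Ell2 C2) : (Tz†) (H α x) = 0 := adjoint_Tz_single _

theorem H₁_apply (α : ℂ) (x : C2) : H₁ α x = !₂[α * x 1, 0] := by
  ext i
  rw [H₁, Matrix.ofLp_toEuclideanCLM]
  fin_cases i <;> simp [Matrix.mulVec, dotProduct, Fin.sum_univ_two]

theorem adjoint_H₁_apply (α : ℂ) (x : C2) : ((H₁ α)†) x = !₂[0, star α * x 0] := by
  refine ext_inner_right ℂ fun y => ?_
  rw [ContinuousLinearMap.adjoint_inner_left, H₁_apply, PiLp.inner_apply, PiLp.inner_apply,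
    Fin.sum_univ_two, Fin.sum_univ_two]
  simp
  ring

theorem adjoint_H_adjoint_H (α : ℂ) (x : Ell2 C2) : ((H α)†) (((H α)†) x) = 0 := by
  have h : ((H₁ α)†) (((H₁ α)†) (x 0)) = 0 := by
    rw [adjoint_H₁_apply, adjoint_H₁_apply]
    ext i; fin_cases i <;> simp
  rw [adjoint_H_apply, adjoint_H_apply, lp.single_apply_self, h, lp.single_zero]

/-- `H₁` and `H₁*` read complementary coordinates of `x 0`, so the left side is exactly `|α|² ‖x
0‖²`. -/
theorem norm_sq_H_add_norm_sq_adjoint_H_le {α : ℂ} (hα : ‖α‖ ≤ 1) (x : Ell2 C2) :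
    ‖((H α)†) x‖ ^ 2 + ‖H α x‖ ^ 2 ≤ ‖x‖ ^ 2 := by
  rw [adjoint_H_apply, H_apply, lp.norm_single (by norm_num), lp.norm_single (by norm_num)]
  have h₁ : ‖((H₁ α)†) (x 0)‖ ^ 2 + ‖H₁ α (x 0)‖ ^ 2 = ‖α‖ ^ 2 * ‖x 0‖ ^ 2 := by
    rw [adjoint_H₁_apply, H₁_apply, EuclideanSpace.norm_sq_eq, EuclideanSpace.norm_sq_eq,
      EuclideanSpace.norm_sq_eq, Fin.sum_univ_two, Fin.sum_univ_two, Fin.sum_univ_two]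
    simp
    ring
  have h₂ : ‖x 0‖ ≤ ‖x‖ := lp.norm_apply_le_norm (by norm_num) x 0
  rw [h₁, ← mul_pow]
  refine pow_le_pow_left₀ (by positivity) ?_ 2
  nlinarith [norm_nonneg (x 0)]

theorem A_apply (α : ℂ) (x : HilbH) : A α x = WithLp.toLp 2 ![0, 0, H α (x 2), 0] := by
  ext1 i
  rw [A, blockOp_apply]
  fin_cases i <;> simp [Fin.sum_univ_four]

theorem adjoint_A (α : ℂ) : (A α)† = diagHStar α := by
  ext1 x
  refine ext_inner_right ℂ fun y => ?_
  rw [ContinuousLinearMap.adjoint_inner_left, A_apply, diagHStar_apply, PiLp.inner_apply,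
    PiLp.inner_apply, Fin.sum_univ_four, Fin.sum_univ_four]
  simp [ContinuousLinearMap.adjoint_inner_left]

theorem adjoint_diagHStar (α : ℂ) : (diagHStar α)† = A α := by
  rw [← adjoint_A, ContinuousLinearMap.adjoint_adjoint]

theorem adjoint_P_apply (x : HilbH) : (P†) x = WithLp.toLp 2 ![x 3, (Tz†) (x 2), 0, 0] := by
  refine ext_inner_right ℂ fun y => ?_
  rw [ContinuousLinearMap.adjoint_inner_left, P_apply, PiLp.inner_apply,
    PiLp.inner_apply, Fin.sum_univ_four, Fin.sum_univ_four]
  simp [ContinuousLinearMap.adjoint_inner_left]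
  ring

theorem adjoint_P_adjoint_P (x : HilbH) : (P†) ((P†) x) = 0 := by
  rw [adjoint_P_apply, adjoint_P_apply]
  ext1 i
  fin_cases i <;> simp

theorem adjoint_P_A (α : ℂ) (x : HilbH) : (P†) (A α x) = 0 := by
  rw [adjoint_P_apply, A_apply]
  ext1 i
  fin_cases i <;> simp [adjoint_Tz_H]

theorem diagHStar_adjoint_P (α : ℂ) (x : HilbH) : diagHStar α ((P†) x) = 0 := by
  rw [adjoint_P_apply, diagHStar_apply]
  ext1 i
  fin_cases i <;> simp

theorem A_adjoint_P (α : ℂ) (x : HilbH) : A α ((P†) x) = 0 := by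
  rw [adjoint_P_apply, A_apply]
  ext1 i
  fin_cases i <;> simp

theorem diagHStar_P (α : ℂ) (x : HilbH) : diagHStar α (P x) = 0 := by
  have h (y : Ell2 C2) : ((H α)†) (Tz y) = 0 := by
    have h0 : (Tz y : Ell2 C2) 0 = 0 := rfl
    rw [adjoint_H_apply, h0, map_zero, lp.single_zero]
  rw [P_apply, diagHStar_apply]
  ext1 i
  fin_cases i <;> simp [h]

theorem A_P (α : ℂ) (x : HilbH) : A α (P x) = 0 := by
  rw [P_apply, A_apply]
  ext1 i
  fin_cases i <;> simp [H_comp_Tz]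

theorem diagHStar_diagHStar (α : ℂ) (x : HilbH) : diagHStar α (diagHStar α x) = 0 := by
  rw [diagHStar_apply, diagHStar_apply]
  ext1 i
  fin_cases i <;> simp [adjoint_H_adjoint_H]

theorem norm_sq_diagHStar_add_norm_sq_A_le {α : ℂ} (hα : ‖α‖ ≤ 1) (x : HilbH) :
    ‖diagHStar α x‖ ^ 2 + ‖A α x‖ ^ 2 ≤ ‖x‖ ^ 2 := by
  rw [diagHStar_apply, A_apply, PiLp.norm_sq_eq_of_L2, PiLp.norm_sq_eq_of_L2,
    PiLp.norm_sq_eq_of_L2, Fin.sum_univ_four, Fin.sum_univ_four, Fin.sum_univ_four]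
  simp
  have := norm_sq_H_add_norm_sq_adjoint_H_le hα (x 2)
  linarith [sq_nonneg ‖x 0‖, sq_nonneg ‖x 1‖, sq_nonneg ‖x 3‖]

end Family

/-! ### Lower triangular operators on a direct sum -/

section LowerTriangular

variable {X Y : Type*} [NormedAddCommGroup X] [InnerProductSpace ℂ X]
  [NormedAddCommGroup Y] [InnerProductSpace ℂ Y]

/-- The operator `(x, y) ↦ (T x, S y + R x)` on `X ⊕ Y`. -/
def lowerTriangular (T : X →L[ℂ] X) (R : X →L[ℂ] Y) (S : Y →L[ℂ] Y) :
    WithLp 2 (X × Y) →L[ℂ] WithLp 2 (X × Y) :=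
  (WithLp.prodContinuousLinearEquiv 2 ℂ X Y).symm.toContinuousLinearMap ∘L
    (T ∘L WithLp.fstL 2 ℂ X Y).prod (S ∘L WithLp.sndL 2 ℂ X Y + R ∘L WithLp.fstL 2 ℂ X Y)

variable (T : X →L[ℂ] X) (R : X →L[ℂ] Y) (S : Y →L[ℂ] Y)

@[simp]
theorem lowerTriangular_fst (x : WithLp 2 (X × Y)) : (lowerTriangular T R S x).fst = T x.fst := rfl

@[simp]
theorem lowerTriangular_snd (x : WithLp 2 (X × Y)) :
    (lowerTriangular T R S x).snd = S x.snd + R x.fst := rfl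

theorem adjoint_lowerTriangular_inl [CompleteSpace X] [CompleteSpace Y] (h : X) :
    ((lowerTriangular T R S)†) (inlIsometry X Y h) = inlIsometry X Y ((T†) h) := by
  have hinl (g : X) (k : WithLp 2 (X × Y)) : inner ℂ (inlIsometry X Y g) k = inner ℂ g k.fst := by
    rw [WithLp.prod_inner_apply]
    exact (congrArg _ (inner_zero_left _)).trans (add_zero _)
  refine ext_inner_right ℂ fun k => ?_
  rw [ContinuousLinearMap.adjoint_inner_left, hinl, hinl, lowerTriangular_fst,
    ContinuousLinearMap.adjoint_inner_left]

end LowerTriangular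

/-! ### The dilation inside the Laurent model -/

section Dilation

universe u

variable {X : Type u} [NormedAddCommGroup X] [InnerProductSpace ℂ X] [CompleteSpace X]

/-- The embedding of `X ⊕ ℓ²(𝒟_Q)` into `ℓ²(ℤ, X)`, for a contraction `Q` with `Q² = 0`: a vector
`h` of `X` goes to the sequence with `D_Q h` at `-1` and `D_Q Q h` at `-3`. -/
def dilationIncl {Q : X →L[ℂ] X} (hQ : ‖Q‖ ≤ 1) (hQQ : ∀ x, Q (Q x) = 0) :
    WithLp 2 (X × Ell2 (defectSpace Q)) →ₗᵢ[ℂ] lp (fun _ : ℤ => X) 2 where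
  toLinearMap := ((ellIncl (defectSpace Q)).toContinuousLinearMap ∘L WithLp.sndL 2 ℂ _ _ +
    lp.singleContinuousLinearMap ℂ (fun _ : ℤ => X) 2 (-1) ∘L defectOp Q ∘L
      WithLp.fstL 2 ℂ _ _ +
    lp.singleContinuousLinearMap ℂ (fun _ : ℤ => X) 2 (-3) ∘L defectOp Q ∘L Q ∘L
      WithLp.fstL 2 ℂ _ _).toLinearMap
  norm_map' x := by
    change ‖ellIncl (defectSpace Q) x.snd + lp.single 2 (-1) (defectOp Q x.fst) +
      lp.single 2 (-3) (defectOp Q (Q x.fst))‖ = ‖x‖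
    -- The sum telescopes: `‖h‖² - ‖Qh‖² + ‖Qh‖² - ‖Q²h‖² = ‖h‖²`, because `Q² = 0`.
    rw [← sq_eq_sq₀ (norm_nonneg _) (norm_nonneg _), norm_sq_add_single_add_single _ (by norm_num)
      (ellIncl_apply_neg _ _ (by norm_num)) (ellIncl_apply_neg _ _ (by norm_num)),
      LinearIsometry.norm_map, norm_sq_defectOp hQ, norm_sq_defectOp hQ, hQQ,
      WithLp.prod_norm_sq_eq_of_L2, norm_zero]
    ring

theorem dilationIncl_apply {Q : X →L[ℂ] X} (hQ : ‖Q‖ ≤ 1) (hQQ : ∀ x, Q (Q x) = 0)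
    (x : WithLp 2 (X × Ell2 (defectSpace Q))) :
    dilationIncl hQ hQQ x = ellIncl _ x.snd + lp.single 2 (-1) (defectOp Q x.fst) +
      lp.single 2 (-3) (defectOp Q (Q x.fst)) := rfl

/-- The coordinate embedding of `Y` into `ℓ²(Y)`. -/
abbrev coordIncl (Y : Type*) [NormedAddCommGroup Y] [InnerProductSpace ℂ Y] (n : ℕ) :
    Y →L[ℂ] Ell2 Y :=
  lp.singleContinuousLinearMap ℂ (fun _ : ℕ => Y) 2 n

/-- The operator matrix with corner entry `G`, first column `K* D_Q` and remaining columns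
`(K, K*)`. -/
def dilationOp₁ {Q : X →L[ℂ] X} (G : X →L[ℂ] X) (K : defectSpace Q →L[ℂ] defectSpace Q) :
    WithLp 2 (X × Ell2 (defectSpace Q)) →L[ℂ] WithLp 2 (X × Ell2 (defectSpace Q)) :=
  lowerTriangular G (coordIncl _ 0 ∘L K† ∘L defectMap Q)
    (ellMap K + unilateralShift _ ∘L ellMap (K†))

/-- The operator matrix with corner entry `0`, first column `(K D_Q, K* D_Q)` and remaining columns
`(0, K, K*)`. -/
def dilationOp₂ {Q : X →L[ℂ] X} (K : defectSpace Q →L[ℂ] defectSpace Q) :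
    WithLp 2 (X × Ell2 (defectSpace Q)) →L[ℂ] WithLp 2 (X × Ell2 (defectSpace Q)) :=
  lowerTriangular 0 (coordIncl _ 0 ∘L K ∘L defectMap Q + coordIncl _ 1 ∘L K† ∘L defectMap Q)
    (unilateralShift _ ∘L (ellMap K + unilateralShift _ ∘L ellMap (K†)))

/-- The operator matrix with corner entry `Q`, first column `(0, D_Q)` and remaining columns
`(0, 0, I)`. -/
def dilationOp₃ (Q : X →L[ℂ] X) :
    WithLp 2 (X × Ell2 (defectSpace Q)) →L[ℂ] WithLp 2 (X × Ell2 (defectSpace Q)) :=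
  lowerTriangular Q (coordIncl _ 1 ∘L defectMap Q) (unilateralShift _ ∘L unilateralShift _)

/-- The Laurent triple extends the three matrices along `dilationIncl`. The symbol `z²` carries `D_Q
h` from `-1` to `1` and `D_Q Q h` from `-3` to `-1`, the place of the `-1` entry of `Qh`. The symbol
`G + zG*` kills the entry at `-3` and turns the one at `-1` into `Gh` at `-1` and `G*h` at `0`; one
more shift gives the second operator. -/
theorem isTetrablockIsometry_dilationOp {Q G : X →L[ℂ] X}
    {K : defectSpace Q →L[ℂ] defectSpace Q} (hQ : ‖Q‖ ≤ 1) (hQQ : ∀ x, Q (Q x) = 0)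
    (hGG : ∀ x, G (G x) = 0) (hle : ∀ x, ‖G x‖ ^ 2 + ‖(G†) x‖ ^ 2 ≤ ‖x‖ ^ 2)
    (hK : ∀ d, (K d : X) = G d) (hK' : ∀ d, ((K†) d : X) = (G†) d)
    (hGQ : ∀ x, G (Q x) = 0) (hGQ' : ∀ x, (G†) (Q x) = 0) (hQG : ∀ x, Q (G x) = 0)
    (hDG : ∀ x, defectOp Q (G x) = G x) (hGD : ∀ x, G (defectOp Q x) = G x)
    (hGD' : ∀ x, (G†) (defectOp Q x) = (G†) x) :
    IsTetrablockIsometry (dilationOp₁ G K) (dilationOp₂ K) (dilationOp₃ Q) := by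
  have hN (x : WithLp 2 (X × Ell2 (defectSpace Q))) :
      (ellMap G + bilateralShift X * ellMap (G†) :
        lp (fun _ : ℤ => X) 2 →L[ℂ] lp (fun _ : ℤ => X) 2) (dilationIncl hQ hQQ x) =
        ellIncl (defectSpace Q) (ellMap K x.snd + unilateralShift _ (ellMap (K†) x.snd)) +
          lp.single 2 (-1) (G x.fst) + lp.single 2 0 ((G†) x.fst) := by
    have key := laurent_ellIncl_add _ hK hK' x.snd (defectOp Q x.fst) (b := defectOp Q (Q x.fst))
      (by rw [hGD, hGQ]) (by rw [hGD', hGQ']) (-1) (-3)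
    rw [hGD, hGD'] at key
    exact key
  have hKD (x : X) : (K (defectMap Q x) : X) = G x := (hK _).trans (hGD x)
  have hKD' (x : X) : ((K†) (defectMap Q x) : X) = (G†) x := (hK' _).trans (hGD' x)
  refine ⟨lp (fun _ : ℤ => X) 2, inferInstance, inferInstance, inferInstance, _, _, _,
    dilationIncl hQ hQQ, isTetrablockUnitary_laurent hGG hle, fun x => ?_, fun x => ?_,
    fun x => ?_⟩
  · rw [hN, dilationIncl_apply, dilationOp₁, lowerTriangular_fst, lowerTriangular_snd, hQG, hDG]
    simp only [map_add, add_apply, ContinuousLinearMap.comp_apply, map_zero, lp.single_zero,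
      lp.singleContinuousLinearMap_apply, ellIncl_single, hKD', Nat.cast_zero]
    abel
  · rw [mul_apply_eq_comp, hN, bilateralShift_ellIncl_add, dilationIncl_apply, dilationOp₂,
      lowerTriangular_fst, lowerTriangular_snd]
    simp only [map_add, add_apply, ContinuousLinearMap.comp_apply, map_zero, lp.single_zero,
      lp.singleContinuousLinearMap_apply, ellIncl_single, hKD, hKD', Nat.cast_zero, Nat.cast_one,
      zero_apply, Int.reduceNeg, neg_add_cancel, zero_add]
    abel
  · rw [mul_apply_eq_comp, dilationIncl_apply, bilateralShift_ellIncl_add,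
      bilateralShift_ellIncl_add, dilationIncl_apply, dilationOp₃,
      lowerTriangular_fst, lowerTriangular_snd, hQQ]
    simp only [map_add, ContinuousLinearMap.comp_apply, map_zero, lp.single_zero,
      lp.singleContinuousLinearMap_apply, ellIncl_single, Nat.cast_one, Int.reduceNeg,
      Int.reduceAdd, add_zero, neg_add_cancel, zero_add]
    rfl

section Entries

variable {Q G : X →L[ℂ] X} {K : defectSpace Q →L[ℂ] defectSpace Q}
  (x : WithLp 2 (X × Ell2 (defectSpace Q))) (n : ℕ)

theorem dilationOp₁_snd_zero :
    (dilationOp₁ G K x).snd 0 = (K†) (defectMap Q x.fst) + K (x.snd 0) := by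
  simp [dilationOp₁, add_comm]

theorem dilationOp₁_snd_succ :
    (dilationOp₁ G K x).snd (n + 1) = (K†) (x.snd n) + K (x.snd (n + 1)) := by
  simp [dilationOp₁, add_comm]

theorem dilationOp₂_snd_zero : (dilationOp₂ K x).snd 0 = K (defectMap Q x.fst) := by
  simp [dilationOp₂]

theorem dilationOp₂_snd_one :
    (dilationOp₂ K x).snd 1 = (K†) (defectMap Q x.fst) + K (x.snd 0) := by
  simp [dilationOp₂, add_comm]

theorem dilationOp₂_snd_add_two :
    (dilationOp₂ K x).snd (n + 2) = (K†) (x.snd n) + K (x.snd (n + 1)) := by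
  simp [dilationOp₂, add_comm]

theorem dilationOp₃_snd_zero : (dilationOp₃ Q x).snd 0 = 0 := by
  simp [dilationOp₃]

theorem dilationOp₃_snd_one : (dilationOp₃ Q x).snd 1 = defectMap Q x.fst := by
  simp [dilationOp₃]

theorem dilationOp₃_snd_add_two : (dilationOp₃ Q x).snd (n + 2) = x.snd n := by
  simp [dilationOp₃]

end Entries

end Dilation

/-! ### The defect space of `P*`, the fundamental operators and the concrete dilation -/

section Defect

theorem adjoint_P_P_adjoint_P (x : HilbH) : (P†) (P ((P†) x)) = (P†) x := by
  have e : (P†) x = WithLp.toLp 2 ![x 3, (Tz†) (x 2), 0, 0] := adjoint_P_apply x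
  rw [adjoint_P_apply, P_apply, e]
  ext1 i
  fin_cases i <;> simp [adjoint_Tz_Tz]

theorem defectOp_adjoint_P_eq : defectOp (P†) = 1 - P * P† := by
  refine defectOp_eq_of_mul_self_eq (by rw [ContinuousLinearMap.adjoint_adjoint]) fun x => ?_
  change x - P ((P†) x) - P ((P†) (x - P ((P†) x))) = x - P ((P†) x)
  rw [map_sub (P†), adjoint_P_P_adjoint_P, sub_self, map_zero, sub_zero]

theorem defectOp_adjoint_P_apply (x : HilbH) : defectOp (P†) x = x - P ((P†) x) := by
  rw [defectOp_adjoint_P_eq]; rfl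

theorem defectOp_adjoint_P_apply' (x : HilbH) :
    defectOp (P†) x = WithLp.toLp 2 ![x 0, x 1, x 2 - Tz ((Tz†) (x 2)), 0] := by
  rw [defectOp_adjoint_P_apply, P_apply, adjoint_P_apply]
  ext1 i
  fin_cases i <;> simp

theorem defectOp_adjoint_P_defectOp (x : HilbH) :
    defectOp (P†) (defectOp (P†) x) = defectOp (P†) x := by
  have h := DFunLike.congr_fun defectOp_sq_adjoint_P x
  rw [ContinuousLinearMap.adjoint_adjoint] at h
  exact h.trans (defectOp_adjoint_P_apply x).symm

/-- The defect operator is idempotent, so its range is its fixed-point set, which is already closed.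
-/
theorem mem_defectSpace_iff (x : HilbH) : x ∈ defectSpace (P†) ↔ defectOp (P†) x = x := by
  refine ⟨fun hx => ?_, fun hx => hx ▸ defectOp_mem _ _⟩
  have hc : IsClosed {y : HilbH | defectOp (P†) y = y} :=
    isClosed_eq (defectOp (P†)).continuous continuous_id
  exact closure_minimal (s := (LinearMap.range (defectOp (P†)).toLinearMap : Set HilbH))
    (by rintro _ ⟨y, rfl⟩; exact defectOp_adjoint_P_defectOp y) hc hx

theorem mem_defectSpace_iff' (x : HilbH) :
    x ∈ defectSpace (P†) ↔ (Tz†) (x 2) = 0 ∧ x 3 = 0 := by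
  rw [mem_defectSpace_iff, defectOp_adjoint_P_apply']
  constructor
  · intro h
    have h₂ := congrArg (fun y : HilbH => y 2) h
    have h₃ := congrArg (fun y : HilbH => y 3) h
    simp only at h₂ h₃
    refine ⟨?_, h₃.symm⟩
    have h₄ : Tz ((Tz†) (x 2)) = 0 := by simpa using h₂
    rw [← adjoint_Tz_Tz ((Tz†) (x 2)), h₄, map_zero]
  · rintro ⟨h₂, h₃⟩
    ext1 i
    fin_cases i <;> simp [h₂, h₃]

theorem defectMap_coe (d : defectSpace (P†)) : defectMap (P†) d = d :=
  Subtype.ext ((mem_defectSpace_iff _).1 d.2)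

theorem coe_defectMap (x : HilbH) : (defectMap (P†) x : HilbH) = defectOp (P†) x := rfl

theorem defectOp_diagHStar (α : ℂ) (x : HilbH) :
    defectOp (P†) (diagHStar α x) = diagHStar α x :=
  (mem_defectSpace_iff _).1 (diagHStar_mem α x)

theorem diagHStar_defectOp (α : ℂ) (x : HilbH) :
    diagHStar α (defectOp (P†) x) = diagHStar α x := by
  rw [defectOp_adjoint_P_apply, map_sub, diagHStar_P, sub_zero]

theorem A_mem (α : ℂ) (x : HilbH) : A α x ∈ defectSpace (P†) := by
  rw [mem_defectSpace_iff, defectOp_adjoint_P_apply, adjoint_P_A, map_zero, sub_zero]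

theorem coe_G₁ (α : ℂ) (d : defectSpace (P†)) : (G₁ α d : HilbH) = diagHStar α d := rfl

/-- `A` also maps into the defect space, so that space reduces `diagHStar` and the adjoint of the
restriction is the restriction of the adjoint. -/
theorem coe_adjoint_G₁ (α : ℂ) (d : defectSpace (P†)) : (((G₁ α)†) d : HilbH) = A α d := by
  suffices ((G₁ α)†) d = ⟨A α d, A_mem α d⟩ from congrArg Subtype.val this
  refine ext_inner_right ℂ fun y => ?_
  rw [ContinuousLinearMap.adjoint_inner_left, Submodule.coe_inner, Submodule.coe_inner, coe_G₁,
    ← adjoint_A, ContinuousLinearMap.adjoint_inner_right]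

theorem adjoint_B : B† = 0 := map_zero _

/-- `D_{P*}` is the identity on `𝒟_{P*}`, so evaluating the equations there determines the unknowns.
The left sides are `A*` and `0`, since `B = 0` and `AP* = 0`. -/
theorem isFundamentalPair_iff (α : ℂ) (X₁ X₂ : defectSpace (P†) →L[ℂ] defectSpace (P†)) :
    IsFundamentalPair ((A α)†) (B†) (P†) X₁ X₂ ↔ X₁ = G₁ α ∧ X₂ = G₂ := by
  constructor
  · rintro ⟨e₁, e₂⟩
    constructor
    · ext d : 2
      have h := DFunLike.congr_fun e₁ (d : HilbH)
      simp only [adjoint_B, map_zero, ContinuousLinearMap.zero_comp, sub_zero, adjoint_A,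
        ContinuousLinearMap.comp_apply, defectMap_coe, Submodule.subtypeL_apply] at h
      rw [(mem_defectSpace_iff _).1 (X₁ d).2] at h
      exact h.symm
    · ext d : 2
      have h := DFunLike.congr_fun e₂ (d : HilbH)
      simp only [adjoint_B, ContinuousLinearMap.adjoint_adjoint, sub_apply,
        ContinuousLinearMap.comp_apply, defectMap_coe, Submodule.subtypeL_apply, A_adjoint_P,
        zero_apply, sub_zero] at h
      rw [(mem_defectSpace_iff _).1 (X₂ d).2] at h
      exact h.symm
  · rintro ⟨rfl, rfl⟩
    constructor
    · ext1 x
      simp only [adjoint_B, map_zero, ContinuousLinearMap.zero_comp, sub_zero, adjoint_A,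
        ContinuousLinearMap.comp_apply, Submodule.subtypeL_apply, coe_G₁, coe_defectMap,
        defectOp_diagHStar, diagHStar_defectOp]
    · ext1 x
      simp [adjoint_B, ContinuousLinearMap.adjoint_adjoint, A_adjoint_P, G₂]

theorem norm_adjoint_P_le : ‖P†‖ ≤ 1 := by
  rw [ContinuousLinearMap.adjoint.norm_map]
  exact ContinuousLinearMap.opNorm_le_bound _ zero_le_one fun x => by simpa using P_norm_le x

theorem A_defectOp (α : ℂ) (x : HilbH) : A α (defectOp (P†) x) = A α x := by
  rw [defectOp_adjoint_P_apply, map_sub, A_P, sub_zero]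

theorem isTetrablockIsometry_dilationOp_G₁ {α : ℂ} (hα : ‖α‖ ≤ 1) :
    IsTetrablockIsometry (dilationOp₁ (diagHStar α) (G₁ α)) (dilationOp₂ (G₁ α))
      (dilationOp₃ (P†)) := by
  have hadj (x : HilbH) : ((diagHStar α)†) x = A α x := by rw [adjoint_diagHStar]
  refine isTetrablockIsometry_dilationOp norm_adjoint_P_le adjoint_P_adjoint_P
    (diagHStar_diagHStar α) (fun x => ?_) (coe_G₁ α) (fun d => ?_) (diagHStar_adjoint_P α)
    (fun x => ?_) (adjoint_P_diagHStar α) (defectOp_diagHStar α) (diagHStar_defectOp α)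
    (fun x => ?_)
  · rw [hadj x]; exact norm_sq_diagHStar_add_norm_sq_A_le hα x
  · exact (coe_adjoint_G₁ α d).trans (hadj d).symm
  · exact (hadj _).trans (A_adjoint_P α x)
  · exact (hadj _).trans ((A_defectOp α x).trans (hadj x).symm)

end Defect

end Tetrablock
end

open Tetrablock

theorem mainTheorem4 (α : ℂ) (hα : ‖α‖ ≤ 1) :
    -- the defect operator and the defect space of `P*`
    defectOp (P†) =
      blockOp !![ContinuousLinearMap.id ℂ (Ell2 C2), 0, 0, 0;
                 0, ContinuousLinearMap.id ℂ (Ell2 C2), 0, 0;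
                 0, 0, ContinuousLinearMap.id ℂ (Ell2 C2) - Tz ∘L Tz†, 0;
                 0, 0, 0, 0] ∧
    (∀ x : HilbH, x ∈ defectSpace (P†) ↔ (Tz†) (x 2) = 0 ∧ x 3 = 0) ∧
    -- `G₁` and `G₂` are the fundamental operators of `(A*, B*, P*)`
    (∀ X₁ X₂ : defectSpace (P†) →L[ℂ] defectSpace (P†),
      IsFundamentalPair ((A α)†) (B†) (P†) X₁ X₂ ↔ X₁ = G₁ α ∧ X₂ = G₂) ∧
    -- the block operator matrices `W₁`, `W₂`, `W₃` define bounded operators on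
    -- `ℋ ⊕ 𝒟_{P*} ⊕ 𝒟_{P*} ⊕ ⋯` and form a tetrablock isometric dilation of `(A*, B*, P*)`
    ∃ W₁ W₂ W₃ : HilbK →L[ℂ] HilbK,
      ((∀ x, (W₁ x).fst = ((A α)†) x.fst) ∧
        (∀ x, (W₁ x).snd 0 = ((G₁ α)†) (defectMap (P†) x.fst) + G₁ α (x.snd 0)) ∧
        (∀ x n, (W₁ x).snd (n + 1) = ((G₁ α)†) (x.snd n) + G₁ α (x.snd (n + 1)))) ∧
      ((∀ x, (W₂ x).fst = (B†) x.fst) ∧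
        (∀ x, (W₂ x).snd 0 = G₁ α (defectMap (P†) x.fst)) ∧
        (∀ x, (W₂ x).snd 1 = ((G₁ α)†) (defectMap (P†) x.fst) + G₁ α (x.snd 0)) ∧
        (∀ x n, (W₂ x).snd (n + 2) = ((G₁ α)†) (x.snd n) + G₁ α (x.snd (n + 1)))) ∧
      ((∀ x, (W₃ x).fst = (P†) x.fst) ∧
        (∀ x, (W₃ x).snd 0 = 0) ∧
        (∀ x, (W₃ x).snd 1 = defectMap (P†) x.fst) ∧
        (∀ x n, (W₃ x).snd (n + 2) = x.snd n)) ∧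
      IsTetrablockIsometricDilation (inlIsometry HilbH (Ell2 (defectSpace (P†))))
        ((A α)†) (B†) (P†) W₁ W₂ W₃ := by
  refine ⟨?_, mem_defectSpace_iff', isFundamentalPair_iff α, dilationOp₁ (diagHStar α) (G₁ α),
    dilationOp₂ (G₁ α), dilationOp₃ (P†), ⟨fun x => ?_, dilationOp₁_snd_zero, dilationOp₁_snd_succ⟩,
    ⟨fun x => ?_, dilationOp₂_snd_zero, dilationOp₂_snd_one, dilationOp₂_snd_add_two⟩,
    ⟨fun x => rfl, dilationOp₃_snd_zero, dilationOp₃_snd_one, dilationOp₃_snd_add_two⟩,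
    isTetrablockIsometry_dilationOp_G₁ hα, ?_, ?_, ?_⟩
  · ext1 x
    rw [defectOp_adjoint_P_apply']
    ext1 i
    rw [blockOp_apply]
    fin_cases i <;> simp [Fin.sum_univ_four]
  · exact DFunLike.congr_fun (adjoint_A α).symm x.fst
  · exact DFunLike.congr_fun adjoint_B.symm x.fst
  -- Triangularity leaves only the corner entry in the adjoint on `ℋ`; the corner `diagHStar α` is
  -- rewritten as `A*`.
  · exact fun x => (adjoint_lowerTriangular_inl _ _ _ x).trans
      (congrArg (fun T => inlIsometry HilbH _ ((T†) x)) (adjoint_A α).symm)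
  · exact fun x => (adjoint_lowerTriangular_inl _ _ _ x).trans
      (congrArg (fun T => inlIsometry HilbH _ ((T†) x)) adjoint_B.symm)
  · exact adjoint_lowerTriangular_inl _ _ _
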